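/- Let $F(x)=\sum_{n\ge 0}a_nx^n\in\mathbb{R}[[x]]$ be the generating function of the Motzkin numbers $a_n=\sum_{i\ge 0}\frac{1}{i+1}\binom{n}{2i}\binom{2i}{i}$. Write $F(x)^2=\sum_{n\ge 0}a_{2,n}x^n$, put $a_{2,n}=0$ for $n<0$, and for $M\in\mathbb{Z}$ and $n\ge 1$ let $D_{2,M}(n)=\det(a_{2,i+j+M})_{i,j=0}^{n-1}$, with $D_{2,M}(0)=1$. Then for all $n\ge 0$, $$D_{2,-1}(n)=\begin{cases}1 & \text{if } n\equiv 0 \pmod 4,\\ 0 & \text{if } n\equiv 1,3 \pmod 4,\\ -1 & \text{if } n\equiv 2 \pmod 4,\end{cases}$$ $$D_{2,-2}(n)=\begin{cases}1 & \text{if } n\equiv 0,9,10,11 \pmod{12},\\ 0 & \text{if } n\equiv 1,2,7,8 \pmod{12},\\ -1 & \text{if } n\equiv 3,4,5,6 \pmod{12},\end{cases}$$ and for all $n\ge 4$, $$D_{2,-3}(n)=\begin{cases}1 & \text{if } n\equiv 0,4 \pmod{12},\\ 0 & \text{if } n\equiv 2,8 \pmod{12},\\ -1 & \text{if } n\equiv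 6,10 \pmod{12},\\ 8k & \text{if } n=12k+1,\\ -8k & \text{if } n=12k+3,\\ 8k+2 & \text{if } n=12k+5,\\ -8k-4 & \text{if } n=12k+7,\\ 8k+4 & \text{if } n=12k+9,\\ -8k-6 & \text{if } n=12k+11,\end{cases}$$ where $k$ denotes a nonnegative integer. -/

import Mathlib

namespace MotzkinHankel

/-- The `n`-th Motzkin number `a_n = ∑_{i ≥ 0} 1/(i+1) * C(n,2i) * C(2i,i)`, as a real number
(the terms with `2 * i > n` vanish). -/
noncomputable def motzkin (n : ℕ) : ℝ :=
  ∑ i ∈ Finset.range (n + 1),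
    (1 / ((i : ℝ) + 1)) * (n.choose (2 * i) : ℝ) * ((2 * i).choose i : ℝ)

/-- The generating function `F(x) = ∑ a_n x^n` of the Motzkin numbers, in `ℝ[[x]]`. -/
noncomputable def motzkinSeries : PowerSeries ℝ := PowerSeries.mk motzkin

/-- The coefficient of `x^n` in a power series for an integer `n`; it is `0` for `n < 0`. -/
noncomputable def intCoeff (G : PowerSeries ℝ) (n : ℤ) : ℝ :=
  if 0 ≤ n then PowerSeries.coeff n.toNat G else 0

/-- The shifted Hankel determinant `D_{K,M}(N) = det (a_{K,i+j+M})_{0 ≤ i,j ≤ N-1}` of the `K`-th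
convolution power `F(x)^K = ∑ a_{K,n} x^n`. For `N = 0` it is the empty determinant `1`. -/
noncomputable def hankelD (F : PowerSeries ℝ) (K : ℕ) (M : ℤ) (N : ℕ) : ℝ :=
  Matrix.det (Matrix.of fun i j : Fin N =>
    intCoeff (F ^ K) (((i : ℕ) : ℤ) + ((j : ℕ) : ℤ) + M))

end MotzkinHankel

/-!
The Hankel matrices are congruent, through unitriangular matrices, to sections of banded matrices
that are Toeplitz away from a corner; determinants of such sections are small determinants in
solutions of a linear recurrence with constant coefficients.

*Congruence.* Put `M = -(s + 1)` with `s = 0, 1, 2`, and let `φ_k = x^k` for `k < s` and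
`φ_k = x^k F^(k + 1 - s)` for `s ≤ k`. By `F = 1 + x F + x² F²` (`motzkinSeries_eq`), the
coefficients of `x^n` in the `φ_k` form the vector `T^n e₀` for a tridiagonal operator `T`
(`motzkinOp_pow_apply`). If `T` is self-adjoint for a symmetric form `β` with
`β(e₀, e_l) = δ_{l, s + 1}`, then `β(T^i e₀, T^j e₀) = β(e₀, T^(i + j) e₀)` is the coefficient of
`x^(i + j)` in `φ_{s + 1} = x^(s + 1) F²`, that is, the `(i, j)` entry of the Hankel matrix. As
`T^i e₀` is `e_i` plus a combination of earlier basis vectors, the Hankel determinant equals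
`det β(e_k, e_l)` (`hankelD_eq_det_symmEntry`). In the three cases such a form exists with `β`
of bandwidth `w = s + 1` and constant `1` on the outermost diagonals.

*Reduction to size `w`.* The `n`-th section of a matrix with `w` superdiagonals, the last of them
constantly `1`, has determinant `(-1)^(w n) det (v_s(n + t))_{s, t < w}`, where `v_0, …, v_{w - 1}`
are the fundamental solutions of `β v = 0` (`det_banded_eq`).

*Periodicity.* The characteristic polynomials of the recurrences are `z² + 1`,
`(z² + 1)(z² + z + 1)` and `(z² + 1)(z² + z + 1)²`. So for `s = 0, 1` the solutions have period `4`
and `12`, and the double roots for `s = 2` cause the linear growth along residues modulo `12`.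
-/

namespace MotzkinHankel

open Finset PowerSeries

/-! ### Determinants of sections of banded matrices -/

section Banded

variable {R : Type*} [CommRing R]

lemma finRotate_pow_apply_val {N : ℕ} (w : ℕ) (i : Fin N) :
    (((finRotate N) ^ w) i : ℕ) = (i + w) % N := by
  obtain _ | N := N
  · exact i.elim0
  induction w with
  | zero => simp [Nat.mod_eq_of_lt i.isLt]
  | succ w ih =>
    rw [pow_succ', Equiv.Perm.mul_apply, finRotate_apply, Fin.val_add, ih, Fin.val_one']
    simp [← add_assoc]

lemma sign_finRotate_pow (n w : ℕ) :
    ((Equiv.Perm.sign (finRotate (n + w) ^ w) : ℤˣ) : R) = (-1) ^ (w * n) := by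
  rw [map_pow, sign_finRotate]
  obtain _ | w := w
  · simp
  · have h : (n + (w + 1) - 1) * (w + 1) = (w + 1) * n + w * (w + 1) := by
      rw [Nat.add_sub_assoc (by omega)]; simp; ring
    rw [← pow_mul, h]
    push_cast
    rw [pow_add, (Nat.even_mul_succ_self w).neg_one_pow, mul_one]

/-- The finite sections of an infinite banded matrix `B` whose `w`-th superdiagonal is constantly
`1`, and which vanishes above it, are given by a `w × w` determinant in the kernel vectors
`v 0, …, v (w - 1)` of `B` with initial values `v s t = δ_{st}` for `t < w`. -/
theorem det_banded_eq {w : ℕ} (B : ℕ → ℕ → R) (v : Fin w → ℕ → R)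
    (hone : ∀ k, B k (k + w) = 1) (hzero : ∀ k l, k + w < l → B k l = 0)
    (hinit : ∀ s t : Fin w, v s t = if s = t then 1 else 0)
    (hker : ∀ s k, ∑ l ∈ range (k + w + 1), B k l * v s l = 0) (n : ℕ) :
    (Matrix.of fun i j : Fin n => B i j).det =
      (-1) ^ (w * n) * (Matrix.of fun s t : Fin w => v s (n + t)).det := by
  classical
  -- `L` has the kernel vectors as first `w` columns, completed by unit vectors; `K` is the first
  -- `n` rows of `B`, completed by unit row vectors; `σ` moves the kernel vectors to the end.
  let L : Matrix (Fin (n + w)) (Fin (n + w)) R := Matrix.of fun i j =>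
    if h : (j : ℕ) < w then v ⟨j, h⟩ i else if i = j then 1 else 0
  let K : Matrix (Fin (n + w)) (Fin (n + w)) R := Matrix.of fun i j =>
    if (i : ℕ) < n then B i j else if i = j then 1 else 0
  let σ : Equiv.Perm (Fin (n + w)) := finRotate (n + w) ^ w
  have hσl (j : Fin n) : (σ (Fin.castAdd w j) : ℕ) = j + w := by
    simp only [σ, finRotate_pow_apply_val, Fin.val_castAdd]
    exact Nat.mod_eq_of_lt (by omega)
  have hσr (s : Fin w) : (σ (Fin.natAdd n s) : ℕ) = s := by
    simp only [σ, finRotate_pow_apply_val, Fin.val_natAdd]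
    rw [show n + (s : ℕ) + w = s + (n + w) by ring, Nat.add_mod_right]
    exact Nat.mod_eq_of_lt (by omega)
  have hL : L.det = 1 := by
    rw [Matrix.det_of_isLowerTriangular]
    · refine Finset.prod_eq_one fun i _ => ?_
      by_cases h : (i : ℕ) < w
      · simpa [L, h] using hinit ⟨i, h⟩ ⟨i, h⟩
      · simp [L, h]
    · intro i j hij
      have hij : i < j := hij
      by_cases h : (j : ℕ) < w
      · have h' : (i : ℕ) < w := lt_trans hij h
        have := hinit ⟨j, h⟩ ⟨i, h'⟩
        simpa [L, h, Fin.ext_iff, (show (i : ℕ) < j from hij).ne'] using this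
      · simp [L, h, hij.ne]
  have hK : K.det = (Matrix.of fun i j : Fin n => B i j).det := by
    rw [← Matrix.det_submatrix_equiv_self (finSumFinEquiv (m := n) (n := w)) K,
      ← Matrix.fromBlocks_toBlocks (K.submatrix _ _)]
    have h21 : (K.submatrix (finSumFinEquiv (m := n) (n := w)) finSumFinEquiv).toBlocks₂₁ = 0 := by
      ext i j
      simp only [Matrix.toBlocks₂₁, Matrix.submatrix_apply, Matrix.of_apply, K]
      simp [Fin.ext_iff]
      omega
    have h22 : (K.submatrix (finSumFinEquiv (m := n) (n := w)) finSumFinEquiv).toBlocks₂₂ = 1 := by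
      ext i j
      simp [Matrix.toBlocks₂₂, K, Fin.ext_iff, Matrix.one_apply]
    have h11 : (K.submatrix (finSumFinEquiv (m := n) (n := w)) finSumFinEquiv).toBlocks₁₁
        = Matrix.of fun i j : Fin n => B i j := by
      ext i j
      simp [Matrix.toBlocks₁₁, K]
    rw [h21, h22, h11, Matrix.det_fromBlocks_zero₂₁, Matrix.det_one, mul_one]
  have hdet : (K * L.submatrix id σ).det =
      (-1) ^ (w * n) * (Matrix.of fun i j : Fin n => B i j).det := by
    rw [Matrix.det_mul, Matrix.det_permute', hL, hK, sign_finRotate_pow]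
    ring
  have hvec (i : Fin n) (s : Fin w) : ∑ x : Fin (n + w), B i x * v s x = 0 := by
    rw [Fin.sum_univ_eq_sum_range (fun x => B i x * v s x), ← hker s i]
    symm
    refine Finset.sum_subset (fun x hx => ?_) (fun x _ hx => ?_)
    · simp only [Finset.mem_range] at *; omega
    · rw [hzero, zero_mul]
      simp only [Finset.mem_range] at *; omega
  -- Since `B` kills the kernel vectors, `K * L` becomes block lower triangular.
  have hdet' : (K * L.submatrix id σ).det = (Matrix.of fun s t : Fin w => v s (n + t)).det := by
    obtain ⟨M, hM⟩ : ∃ M, M = (K * L.submatrix id σ).submatrix (finSumFinEquiv (m := n) (n := w))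
      finSumFinEquiv := ⟨_, rfl⟩
    have h12 : M.toBlocks₁₂ = 0 := by
      ext i s
      simp only [Matrix.toBlocks₁₂, hM, Matrix.submatrix_apply, Matrix.of_apply, Matrix.mul_apply,
        Matrix.zero_apply]
      rw [← hvec i s]
      refine Finset.sum_congr rfl fun x _ => ?_
      simp [K, L, hσr]
    have h22 : M.toBlocks₂₂ = (Matrix.of fun s t : Fin w => v s (n + t)).transpose := by
      ext t s
      simp [Matrix.toBlocks₂₂, hM, Matrix.mul_apply, K, L, hσr]
    have h11 : M.toBlocks₁₁.det = 1 := by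
      have h (i j : Fin n) : M.toBlocks₁₁ i j = B i (j + w) := by
        have hne : ¬ ((j : ℕ) + w < w) := by omega
        simp only [Matrix.toBlocks₁₁, hM, Matrix.submatrix_apply, Matrix.of_apply,
          Matrix.mul_apply, K, L, finSumFinEquiv_apply_left, hσl, id, dif_neg hne]
        rw [Finset.sum_eq_single (σ (Fin.castAdd w j))]
        · simp [hσl]
        · intro x _ hx
          simp [hx]
        · simp
      rw [Matrix.det_of_isLowerTriangular]
      · exact Finset.prod_eq_one fun i _ => by rw [h, hone]
      · intro i j hij
        have hij : (i : ℕ) < j := hij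
        rw [h, hzero _ _ (by omega)]
    rw [← Matrix.det_submatrix_equiv_self (finSumFinEquiv (m := n) (n := w)), ← hM,
      ← Matrix.fromBlocks_toBlocks M, h12, Matrix.det_fromBlocks_zero₁₂, h11, h22,
      Matrix.det_transpose, one_mul]
  rw [← hdet', hdet, ← mul_assoc, ← mul_pow]
  simp

end Banded

/-! ### The functional equation of the Motzkin series -/

lemma coeff_X_mul_mk_one_pow_mul (i n : ℕ) :
    coeff n (((X : PowerSeries ℝ) * PowerSeries.mk 1) ^ (2 * i) * PowerSeries.mk 1) =
      (n.choose (2 * i) : ℝ) := by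
  rw [mul_pow, mul_assoc, ← pow_succ, mk_one_pow_eq_mk_choose_add]
  by_cases h : 2 * i ≤ n
  · obtain ⟨m, rfl⟩ := Nat.exists_eq_add_of_le h
    rw [add_comm, coeff_X_pow_mul, coeff_mk, add_comm]
  · rw [coeff_X_pow_mul', if_neg h, Nat.choose_eq_zero_of_lt (by omega)]
    simp

/-- The Motzkin numbers are a binomial transform of the Catalan numbers: with `u = x / (1 - x)`,
`F(x) = C(u²) / (1 - x)`. -/
theorem motzkinSeries_eq_subst :
    motzkinSeries =
      (catalanSeries.map (Nat.castRingHom ℝ)).subst (((X : PowerSeries ℝ) * PowerSeries.mk 1) ^ 2) *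
        PowerSeries.mk 1 := by
  have hs : HasSubst (((X : PowerSeries ℝ) * PowerSeries.mk 1) ^ 2) :=
    HasSubst.of_constantCoeff_zero' (by simp)
  have hvanish (i k : ℕ) (h : k < 2 * i) :
      coeff k ((((X : PowerSeries ℝ) * PowerSeries.mk 1) ^ 2) ^ i) = 0 := by
    rw [← pow_mul, mul_pow, coeff_X_pow_mul', if_neg (by omega)]
  ext n
  have hcoeff (k : ℕ) (hk : k ≤ n) :
      coeff k ((catalanSeries.map (Nat.castRingHom ℝ)).subst
          (((X : PowerSeries ℝ) * PowerSeries.mk 1) ^ 2)) =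
        ∑ i ∈ range (n + 1), (catalan i : ℝ) *
          coeff k ((((X : PowerSeries ℝ) * PowerSeries.mk 1) ^ 2) ^ i) := by
    rw [coeff_subst' hs, finsum_eq_sum_of_support_subset (s := range (n + 1))]
    · simp
    · intro i hi
      rw [Function.mem_support] at hi
      rw [Finset.coe_range, Set.mem_Iio]
      by_contra hlt
      exact hi (by rw [hvanish i k (by omega), smul_zero])
  have hsum : coeff n ((catalanSeries.map (Nat.castRingHom ℝ)).subst
      (((X : PowerSeries ℝ) * PowerSeries.mk 1) ^ 2) * PowerSeries.mk 1) =
      ∑ i ∈ range (n + 1), (catalan i : ℝ) * (n.choose (2 * i) : ℝ) := by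
    simp_rw [← coeff_X_mul_mk_one_pow_mul, pow_mul, coeff_mul _ _ (PowerSeries.mk 1),
      Finset.mul_sum]
    rw [Finset.sum_comm]
    refine Finset.sum_congr rfl fun p hp => ?_
    rw [hcoeff p.1 (by have := HasAntidiagonal.mem_antidiagonal.1 hp; omega), Finset.sum_mul]
    exact Finset.sum_congr rfl fun i _ => mul_assoc _ _ _
  rw [hsum, motzkinSeries, coeff_mk, motzkin]
  refine Finset.sum_congr rfl fun i _ => ?_
  rw [← Nat.centralBinom_eq_two_mul_choose, ← succ_mul_catalan_eq_centralBinom]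
  push_cast
  field_simp

/-- The equation `F = 1 + x F + x² F²`, obtained from `C(z) = 1 + z C(z)²` at `z = (x / (1 - x))²`,
where `C` is the Catalan series. -/
theorem motzkinSeries_eq :
    motzkinSeries = 1 + X * motzkinSeries + X ^ 2 * motzkinSeries ^ 2 := by
  have hs : HasSubst (((X : PowerSeries ℝ) * PowerSeries.mk 1) ^ 2) :=
    HasSubst.of_constantCoeff_zero' (by simp)
  have hC := congrArg
    (fun f => (f.map (Nat.castRingHom ℝ)).subst (((X : PowerSeries ℝ) * PowerSeries.mk 1) ^ 2))
    catalanSeries_sq_mul_X_add_one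
  simp only [map_add, map_mul, map_pow, map_one, PowerSeries.map_X] at hC
  rw [← coe_substAlgHom hs] at hC
  simp only [map_add, map_mul, map_pow, map_one, substAlgHom_X] at hC
  rw [motzkinSeries_eq_subst, ← coe_substAlgHom hs]
  generalize substAlgHom hs (catalanSeries.map (Nat.castRingHom ℝ)) = c at hC ⊢
  have hone : (PowerSeries.mk 1 : PowerSeries ℝ) * (1 - X) = 1 := mk_one_mul_one_sub_eq_one ℝ
  linear_combination (-1 : PowerSeries ℝ) * hC + c * hone

/-! ### The shifted Motzkin operator -/

/-- The image of the basis vector `e_k` under the shifted Motzkin operator: `e_{k+1}` for `k < s`,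
`e_s + e_{s+1}` for `k = s`, and `e_{k-1} + e_k + e_{k+1}` for `k > s`. -/
noncomputable def motzkinStep (s k : ℕ) : ℕ →₀ ℝ :=
  if k < s then Finsupp.single (k + 1) 1
  else if k = s then Finsupp.single k 1 + Finsupp.single (k + 1) 1
  else Finsupp.single (k - 1) 1 + Finsupp.single k 1 + Finsupp.single (k + 1) 1

/-- The shifted Motzkin operator on finitely supported sequences. For `s = 0` its powers count
Motzkin paths by length and final height; for general `s` it first climbs `s` steps, without
returning. -/
noncomputable def motzkinOp (s : ℕ) : (ℕ →₀ ℝ) →ₗ[ℝ] (ℕ →₀ ℝ) :=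
  Finsupp.linearCombination ℝ (motzkinStep s)

lemma motzkinOp_single (s k : ℕ) : motzkinOp s (Finsupp.single k 1) = motzkinStep s k := by
  simp [motzkinOp]

lemma motzkinOp_apply_succ (s k : ℕ) (p : ℕ →₀ ℝ) :
    motzkinOp s p (k + 1) =
      if k + 1 < s then p k else p k + p (k + 1) + p (k + 2) := by
  induction p using Finsupp.induction_linear with
  | zero => simp
  | add p q hp hq =>
    rw [map_add (motzkinOp s), Finsupp.add_apply, hp, hq]
    simp only [Finsupp.add_apply]
    grind
  | single l a =>
    simp only [motzkinOp, Finsupp.linearCombination_single, Finsupp.smul_apply, motzkinStep,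
      smul_eq_mul]
    split_ifs <;> simp [Finsupp.single_apply] <;> grind

lemma motzkinOp_apply_zero (s : ℕ) (p : ℕ →₀ ℝ) :
    motzkinOp s p 0 = if 0 < s then 0 else p 0 + p 1 := by
  induction p using Finsupp.induction_linear with
  | zero => simp
  | add p q hp hq =>
    rw [map_add (motzkinOp s), Finsupp.add_apply, hp, hq]
    simp only [Finsupp.add_apply]
    grind
  | single l a =>
    simp only [motzkinOp, Finsupp.linearCombination_single, Finsupp.smul_apply, motzkinStep,
      smul_eq_mul]
    split_ifs <;> simp [Finsupp.single_apply] <;> grind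

/-- The truncated subtraction makes the exponent of the Motzkin series `0` for `k < s`, where the
`k`-th series is `x^k`. -/
theorem motzkinOp_pow_apply (s n k : ℕ) :
    (motzkinOp s ^ n) (Finsupp.single 0 1) k = coeff n (X ^ k * motzkinSeries ^ (k + 1 - s)) := by
  have hF := motzkinSeries_eq
  have hconst : constantCoeff motzkinSeries = 1 := by
    rw [hF]; simp
  induction n generalizing k with
  | zero =>
    obtain _ | k := k
    · simp [hconst]
    · simp
  | succ n ih =>
    rw [pow_succ', Module.End.mul_apply]
    obtain _ | k := k
    · rw [motzkinOp_apply_zero, ih, ih]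
      split_ifs with h
      · rw [show 0 + 1 - s = 0 by omega]
        simp [coeff_one]
      · obtain rfl : s = 0 := by omega
        rw [← map_add, ← coeff_succ_X_mul, ← sub_eq_zero, ← map_sub,
          show X * (X ^ 0 * motzkinSeries ^ (0 + 1 - 0) + X ^ 1 * motzkinSeries ^ (1 + 1 - 0)) -
            X ^ 0 * motzkinSeries ^ (0 + 1 - 0) = -1 by
            norm_num; linear_combination -hF]
        simp [coeff_one]
    · rw [motzkinOp_apply_succ, ih, ih, ih]
      split_ifs with h
      · rw [← coeff_succ_X_mul, show k + 1 - s = 0 by omega, show k + 1 + 1 - s = 0 by omega]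
        ring_nf
      · obtain ⟨j, hj⟩ : ∃ j, k + 1 = s + j := Nat.exists_eq_add_of_le (by omega)
        rw [show k + 1 - s = j by omega, show k + 1 + 1 - s = j + 1 by omega,
          show k + 2 + 1 - s = j + 2 by omega, ← map_add, ← map_add, ← coeff_succ_X_mul]
        congr 1
        linear_combination (-X ^ (k + 1) * motzkinSeries ^ j) * hF

/-! ### Congruence of the Hankel matrix to a banded matrix -/

/-- The entries of the symmetric infinite matrix with `b k d` at the places `(k, k + d)` and
`(k + d, k)`. -/
def symmEntry (b : ℕ → ℕ → ℝ) (k l : ℕ) : ℝ := if k ≤ l then b k (l - k) else b l (k - l)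

lemma symmEntry_comm (b : ℕ → ℕ → ℝ) (k l : ℕ) : symmEntry b k l = symmEntry b l k := by
  unfold symmEntry
  obtain h | rfl | h := lt_trichotomy k l
  · rw [if_pos h.le, if_neg h.not_ge]
  · rfl
  · rw [if_pos h.le, if_neg h.not_ge]

lemma symmEntry_of_eq_add (b : ℕ → ℕ → ℝ) {k l d : ℕ} (h : l = k + d) :
    symmEntry b k l = b k d := by
  subst h
  simp [symmEntry]

/-- The symmetric bilinear form with Gram matrix `symmEntry b` on the standard basis. -/
noncomputable def symmForm (b : ℕ → ℕ → ℝ) : (ℕ →₀ ℝ) →ₗ[ℝ] (ℕ →₀ ℝ) →ₗ[ℝ] ℝ :=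
  Finsupp.linearCombination ℝ fun k => Finsupp.linearCombination ℝ (symmEntry b k)

lemma symmForm_single (b : ℕ → ℕ → ℝ) (k l : ℕ) :
    symmForm b (Finsupp.single k 1) (Finsupp.single l 1) = symmEntry b k l := by
  simp [symmForm]

/-- The conditions on the entries `b` under which the shifted Motzkin operator is self-adjoint for
`symmForm b`. They express `β(T e_k, e_l) = β(e_k, T e_l)` for `k < l`, where the cases differ in the
position of `k` and `l = k + d + 1` relative to the shift `s`. -/
structure IsCompatible (s : ℕ) (b : ℕ → ℕ → ℝ) : Prop where
  of_le : ∀ k d, s ≤ k → b k (d + 2) + b (k + 2) d = b (k + 1) d + b (k + 1) (d + 2)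
  at_eq : ∀ d, b (s + 1) d = b s d + b s (d + 2)
  below_lt : ∀ k d, k + d + 1 < s → b (k + 1) d = b k (d + 2)
  below_eq : ∀ k d, k + d + 1 = s → b (k + 1) d = b k (d + 1) + b k (d + 2)
  below_gt : ∀ k d, k < s → s < k + d + 1 → b (k + 1) d = b k d + b k (d + 1) + b k (d + 2)

lemma symmForm_motzkinStep {s : ℕ} {b : ℕ → ℕ → ℝ} (hb : IsCompatible s b) {k l : ℕ} (h : k < l) :
    symmForm b (motzkinStep s k) (Finsupp.single l 1) =
      symmForm b (Finsupp.single k 1) (motzkinStep s l) := by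
  obtain ⟨d, rfl⟩ : ∃ d, l = k + d + 1 := Nat.exists_eq_add_of_lt h
  have e (k l d : ℕ) (h : l = k + d) := symmEntry_of_eq_add b h
  rcases lt_trichotomy k s with hk | rfl | hk
  · rcases lt_trichotomy (k + d + 1) s with hl | hl | hl
    · simp only [motzkinStep, if_pos hk, if_pos hl, symmForm_single]
      rw [e (k + 1) _ d (by omega), e k _ (d + 2) (by omega), hb.below_lt k d hl]
    · simp only [motzkinStep, if_pos hk, if_pos hl, if_neg hl.not_lt, symmForm_single, map_add]
      rw [e (k + 1) _ d (by omega), e k _ (d + 1) (by omega), e k _ (d + 2) (by omega),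
        hb.below_eq k d hl]
    · simp only [motzkinStep, if_pos hk, if_neg hl.ne', if_neg hl.not_gt, symmForm_single, map_add]
      rw [e (k + 1) _ d (by omega), e k (k + d + 1 - 1) d (by omega), e k _ (d + 1) (by omega),
        e k _ (d + 2) (by omega), hb.below_gt k d hk hl]
  · have hl : k < k + d + 1 := h
    simp only [motzkinStep, if_neg (lt_irrefl k), if_true, if_neg hl.ne', if_neg hl.not_gt,
      symmForm_single, map_add, LinearMap.add_apply]
    rw [e (k + 1) _ d (by omega), e k (k + d + 1 - 1) d (by omega), e k _ (d + 1) (by omega),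
      e k _ (d + 2) (by omega), hb.at_eq d]
    ring
  · have hl : s < k + d + 1 := hk.trans h
    obtain ⟨k, rfl⟩ : ∃ j, k = j + 1 := ⟨k - 1, by omega⟩
    simp only [motzkinStep, if_neg hk.ne', if_neg hk.not_gt, if_neg hl.ne', if_neg hl.not_gt,
      symmForm_single, map_add, LinearMap.add_apply]
    rw [e (k + 1 - 1) _ (d + 2) (by omega), e (k + 1) (k + 1 + d + 1) (d + 1) (by omega),
      e (k + 1 + 1) _ d (by omega), e (k + 1) (k + 1 + d + 1 - 1) d (by omega),
      e (k + 1) (k + 1 + d + 1 + 1) (d + 2) (by omega), Nat.add_sub_cancel]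
    linarith [hb.of_le k d (by omega)]

lemma symmForm_comm (b : ℕ → ℕ → ℝ) (p q : ℕ →₀ ℝ) : symmForm b p q = symmForm b q p := by
  have : symmForm b = (symmForm b).flip := by
    ext k l
    simp [symmForm, symmEntry_comm b k l]
  exact DFunLike.congr_fun (DFunLike.congr_fun this p) q

theorem symmForm_motzkinOp {s : ℕ} {b : ℕ → ℕ → ℝ} (hb : IsCompatible s b) (p q : ℕ →₀ ℝ) :
    symmForm b (motzkinOp s p) q = symmForm b p (motzkinOp s q) := by
  have : symmForm b ∘ₗ motzkinOp s = (symmForm b).compl₂ (motzkinOp s) := by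
    ext k l
    simp only [LinearMap.comp_apply, Finsupp.lsingle_apply, LinearMap.compl₂_apply,
      motzkinOp_single]
    obtain h | rfl | h := lt_trichotomy k l
    · exact symmForm_motzkinStep hb h
    · exact symmForm_comm b _ _
    · rw [symmForm_comm, symmForm_comm b (Finsupp.single k 1)]
      exact (symmForm_motzkinStep hb h).symm
  exact DFunLike.congr_fun (DFunLike.congr_fun this p) q

lemma symmForm_motzkinOp_pow {s : ℕ} {b : ℕ → ℕ → ℝ} (hb : IsCompatible s b) (i : ℕ)
    (p q : ℕ →₀ ℝ) :
    symmForm b ((motzkinOp s ^ i) p) q = symmForm b p ((motzkinOp s ^ i) q) := by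
  induction i generalizing p q with
  | zero => simp
  | succ i ih =>
    rw [pow_succ', Module.End.mul_apply, symmForm_motzkinOp hb, ih, ← Module.End.mul_apply,
      ← pow_succ, pow_succ']

lemma symmForm_apply (b : ℕ → ℕ → ℝ) {N : ℕ} {p q : ℕ →₀ ℝ} (hp : ∀ k, N ≤ k → p k = 0)
    (hq : ∀ k, N ≤ k → q k = 0) :
    symmForm b p q = ∑ k : Fin N, ∑ l : Fin N, p k * symmEntry b k l * q l := by
  have hs (r : ℕ →₀ ℝ) (hr : ∀ k, N ≤ k → r k = 0) : r.support ⊆ range N := by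
    intro k hk
    by_contra h
    exact Finsupp.mem_support_iff.1 hk (hr k (by simpa using h))
  rw [Fin.sum_univ_eq_sum_range (fun k => ∑ l : Fin N, p k * symmEntry b k l * q l), symmForm,
    Finsupp.linearCombination_apply, Finsupp.sum_of_support_subset _ (hs p hp) _ (by simp),
    LinearMap.sum_apply]
  refine Finset.sum_congr rfl fun k _ => ?_
  rw [Fin.sum_univ_eq_sum_range (fun l => p k * symmEntry b k l * q l), LinearMap.smul_apply,
    Finsupp.linearCombination_apply, Finsupp.sum_of_support_subset _ (hs q hq) _ (by simp),
    smul_eq_mul, Finset.mul_sum]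
  refine Finset.sum_congr rfl fun l _ => ?_
  rw [smul_eq_mul]
  ring

/-- The Hankel determinant of `F²` with shift `-(s + 1)` is the determinant of a section of the Gram
matrix of any form that makes the shifted Motzkin operator self-adjoint and has first row
`e_{s+1}`. -/
theorem hankelD_eq_det_symmEntry {s : ℕ} {b : ℕ → ℕ → ℝ} (hb : IsCompatible s b)
    (hrow : ∀ l, b 0 l = if l = s + 1 then 1 else 0) (N : ℕ) :
    hankelD motzkinSeries 2 (-(s + 1 : ℕ)) N =
      (Matrix.of fun k l : Fin N => symmEntry b k l).det := by
  -- The rows of the unitriangular matrix `P` are the vectors `T^i e₀`.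
  let P : Matrix (Fin N) (Fin N) ℝ :=
    Matrix.of fun i k => (motzkinOp s ^ (i : ℕ)) (Finsupp.single 0 1) k
  have hlow (i k : ℕ) (h : i < k) : (motzkinOp s ^ i) (Finsupp.single 0 1) k = 0 := by
    rw [motzkinOp_pow_apply, coeff_X_pow_mul', if_neg (by omega)]
  have hP : P.det = 1 := by
    rw [Matrix.det_of_isLowerTriangular]
    · refine Finset.prod_eq_one fun i _ => ?_
      have hconst : constantCoeff motzkinSeries = 1 := by rw [motzkinSeries_eq]; simp
      simp [P, motzkinOp_pow_apply, coeff_X_pow_mul', hconst]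
    · intro i j hij
      exact hlow i j hij
  have hfirst (n : ℕ) : symmForm b (Finsupp.single 0 1) ((motzkinOp s ^ n) (Finsupp.single 0 1)) =
      intCoeff (motzkinSeries ^ 2) ((n : ℤ) + (-(s + 1 : ℕ))) := by
    rw [symmForm, Finsupp.linearCombination_single, one_smul, Finsupp.linearCombination_apply,
      Finsupp.sum, Finset.sum_eq_single (s + 1)]
    · rw [symmEntry_of_eq_add b (zero_add _).symm, hrow, if_pos rfl, motzkinOp_pow_apply,
        coeff_X_pow_mul', intCoeff, show s + 1 + 1 - s = 2 by omega, smul_eq_mul, mul_one]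
      have : (0 ≤ (n : ℤ) + (-(s + 1 : ℕ))) ↔ s + 1 ≤ n := by omega
      simp only [this]
      split_ifs with h
      · congr 2; omega
      · rfl
    · intro l _ hl
      rw [symmEntry_of_eq_add b (zero_add l).symm, hrow, if_neg hl, smul_zero]
    · intro h
      rw [Finsupp.notMem_support_iff.1 h, zero_smul]
  have hmul : (Matrix.of fun i j : Fin N =>
      intCoeff (motzkinSeries ^ 2) (((i : ℕ) : ℤ) + ((j : ℕ) : ℤ) + (-(s + 1 : ℕ)))) =
      P * (Matrix.of fun k l : Fin N => symmEntry b k l) * P.transpose := by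
    ext i j
    rw [Matrix.of_apply, ← Nat.cast_add, ← hfirst, pow_add, Module.End.mul_apply,
      ← symmForm_motzkinOp_pow hb,
      symmForm_apply b (N := N) (fun k hk => hlow _ _ (by omega)) (fun k hk => hlow _ _ (by omega))]
    simp only [Matrix.mul_apply, Matrix.transpose_apply, Finset.sum_mul]
    rw [Finset.sum_comm]
    rfl
  rw [hankelD, hmul, Matrix.det_mul, Matrix.det_mul, Matrix.det_transpose, hP]
  ring

/-! ### The three banded matrices and their kernels -/

/-- The sequence `a₀, a₁, a₂, a₃, 0, 0, …`, used as the part of a matrix row to the right of, and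
including, the diagonal. -/
def bandRow (a₀ a₁ a₂ a₃ : ℝ) : ℕ → ℝ
  | 0 => a₀
  | 1 => a₁
  | 2 => a₂
  | 3 => a₃
  | _ + 4 => 0

/-- The matrix congruent to the Hankel matrix with shift `-1`: the adjacency matrix of a path. -/
def bandOne : ℕ → ℕ → ℝ
  | _ => bandRow 0 1 0 0

/-- The matrix congruent to the Hankel matrix with shift `-2`. With `S` the adjacency matrix of a
path, it is `S² + S`, preceded by one row and column that only meet it in one entry `1`. -/
def bandTwo : ℕ → ℕ → ℝ
  | 0 => bandRow 0 0 1 0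
  | 1 => bandRow 1 1 1 0
  | _ + 2 => bandRow 2 1 1 0

/-- The matrix congruent to the Hankel matrix with shift `-3`. With `S` the adjacency matrix of a
path, it is `S³ + 2 S² + S`, preceded by two rows and columns. -/
def bandThree : ℕ → ℕ → ℝ
  | 0 => bandRow 0 0 0 1
  | 1 => bandRow 0 1 1 1
  | 2 => bandRow 2 3 2 1
  | _ + 3 => bandRow 4 4 2 1

lemma bandRow_eq_zero (a₀ a₁ a₂ a₃ : ℝ) {d : ℕ} (h : 4 ≤ d) : bandRow a₀ a₁ a₂ a₃ d = 0 := by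
  obtain ⟨d, rfl⟩ := Nat.exists_eq_add_of_le' h
  rfl

lemma isCompatible_bandOne : IsCompatible 0 bandOne where
  of_le k d _ := by simp only [bandOne]; ring
  at_eq d := by obtain _ | _ | _ | _ | d := d <;> norm_num [bandOne, bandRow]
  below_lt k d h := by omega
  below_eq k d h := by omega
  below_gt k d h := by omega

lemma isCompatible_bandTwo : IsCompatible 1 bandTwo where
  of_le k d h := by
    obtain _ | _ | k := k
    · omega
    all_goals obtain _ | _ | _ | _ | d := d <;> norm_num [bandTwo, bandRow]
  at_eq d := by obtain _ | _ | _ | _ | d := d <;> norm_num [bandTwo, bandRow]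
  below_lt k d h := by omega
  below_eq k d h := by
    obtain ⟨rfl, rfl⟩ : k = 0 ∧ d = 0 := by omega
    norm_num [bandTwo, bandRow]
  below_gt k d h h' := by
    obtain rfl : k = 0 := by omega
    obtain _ | _ | _ | _ | d := d <;>
      first | omega | norm_num [bandTwo, bandRow]

lemma isCompatible_bandThree : IsCompatible 2 bandThree where
  of_le k d h := by
    obtain _ | _ | _ | k := k
    · omega
    · omega
    all_goals obtain _ | _ | _ | _ | d := d <;> norm_num [bandThree, bandRow]
  at_eq d := by obtain _ | _ | _ | _ | d := d <;> norm_num [bandThree, bandRow]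
  below_lt k d h := by
    obtain ⟨rfl, rfl⟩ : k = 0 ∧ d = 0 := by omega
    norm_num [bandThree, bandRow]
  below_eq k d h := by
    obtain ⟨rfl, rfl⟩ | ⟨rfl, rfl⟩ : (k = 0 ∧ d = 1) ∨ (k = 1 ∧ d = 0) := by omega
    all_goals norm_num [bandThree, bandRow]
  below_gt k d h h' := by
    obtain rfl | rfl : k = 0 ∨ k = 1 := by omega
    all_goals obtain _ | _ | _ | _ | d := d <;>
      first | omega | norm_num [bandThree, bandRow]

lemma symmEntry_eq_zero {b : ℕ → ℕ → ℝ} {w : ℕ} (hw : ∀ k d, w < d → b k d = 0) {k l : ℕ}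
    (h : k + w < l ∨ l + w < k) : symmEntry b k l = 0 := by
  unfold symmEntry
  split_ifs <;> exact hw _ _ (by omega)

/-- Away from its first `w` rows, row `m + w` of a matrix of bandwidth `w` starts in column `m`. -/
lemma sum_symmEntry_mul {b : ℕ → ℕ → ℝ} {w : ℕ} (hw : ∀ k d, w < d → b k d = 0) (v : ℕ → ℝ)
    (m : ℕ) :
    ∑ l ∈ range (m + w + w + 1), symmEntry b (m + w) l * v l =
      ∑ l ∈ range (w + w + 1), symmEntry b (m + w) (m + l) * v (m + l) := by
  rw [add_assoc m, add_assoc m, Finset.sum_range_add, Finset.sum_eq_zero, zero_add]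
  intro l hl
  rw [symmEntry_eq_zero hw, zero_mul]
  have := Finset.mem_range.1 hl
  omega

/-- The kernel vector of the infinite matrix `bandOne` with initial value `a`. -/
def kernelOne (a : ℝ) : ℕ → ℝ
  | 0 => a
  | 1 => 0
  | n + 2 => -kernelOne a n

/-- The kernel vector of the infinite matrix `bandTwo` with initial values `a, b`. The recurrence
with constant coefficients only holds from index `5` on. -/
def kernelTwo (a b : ℝ) : ℕ → ℝ
  | 0 => a
  | 1 => b
  | 2 => 0
  | 3 => -b
  | 4 => -a
  | n + 5 => -(kernelTwo a b (n + 4) + 2 * kernelTwo a b (n + 3) + kernelTwo a b (n + 2) +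
      kernelTwo a b (n + 1))

/-- The kernel vector of the infinite matrix `bandThree` with initial values `a, b, c`. The
recurrence with constant coefficients only holds from index `7` on. -/
def kernelThree (a b c : ℝ) : ℕ → ℝ
  | 0 => a
  | 1 => b
  | 2 => c
  | 3 => 0
  | 4 => -c
  | 5 => -b
  | 6 => -a + b + c
  | n + 7 => -(2 * kernelThree a b c (n + 6) + 4 * kernelThree a b c (n + 5) +
      4 * kernelThree a b c (n + 4) + 4 * kernelThree a b c (n + 3) +
      2 * kernelThree a b c (n + 2) + kernelThree a b c (n + 1))

lemma bandOne_eq_zero (k d : ℕ) (h : 1 < d) : bandOne k d = 0 := by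
  obtain _ | _ | _ | _ | d := d <;> simp [bandOne, bandRow] at h ⊢

lemma bandTwo_eq_zero (k d : ℕ) (h : 2 < d) : bandTwo k d = 0 := by
  obtain _ | _ | k := k <;> obtain _ | _ | _ | _ | d := d <;> simp [bandTwo, bandRow] at h ⊢

lemma bandThree_eq_zero (k d : ℕ) (h : 3 < d) : bandThree k d = 0 := by
  obtain _ | _ | _ | k := k <;> exact bandRow_eq_zero _ _ _ _ h

lemma sum_bandOne_mul_kernelOne (a : ℝ) (k : ℕ) :
    ∑ l ∈ range (k + 1 + 1), symmEntry bandOne k l * kernelOne a l = 0 := by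
  obtain _ | k := k
  · simp [Finset.sum_range_succ, symmEntry, bandOne, bandRow, kernelOne]
  · rw [sum_symmEntry_mul bandOne_eq_zero]
    simp [Finset.sum_range_succ, symmEntry, bandOne, bandRow, kernelOne]

lemma sum_bandTwo_mul_kernelTwo (a b : ℝ) (k : ℕ) :
    ∑ l ∈ range (k + 2 + 1), symmEntry bandTwo k l * kernelTwo a b l = 0 := by
  obtain hk | ⟨k, rfl⟩ : k < 4 ∨ ∃ j, k = j + 2 + 2 :=
    (Nat.lt_or_ge k 4).imp_right Nat.exists_eq_add_of_le'
  · interval_cases k <;>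
      (simp [Finset.sum_range_succ, symmEntry, bandTwo, bandRow, kernelTwo]; try ring)
  rw [sum_symmEntry_mul bandTwo_eq_zero]
  simp [Finset.sum_range_succ, symmEntry, bandTwo, bandRow, kernelTwo]
  ring

lemma sum_bandThree_mul_kernelThree (a b c : ℝ) (k : ℕ) :
    ∑ l ∈ range (k + 3 + 1), symmEntry bandThree k l * kernelThree a b c l = 0 := by
  obtain hk | ⟨k, rfl⟩ : k < 6 ∨ ∃ j, k = j + 3 + 3 :=
    (Nat.lt_or_ge k 6).imp_right Nat.exists_eq_add_of_le'
  · interval_cases k <;>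
      (simp [Finset.sum_range_succ, symmEntry, bandThree, bandRow, kernelThree]; try ring)
  rw [sum_symmEntry_mul bandThree_eq_zero]
  simp [Finset.sum_range_succ, symmEntry, bandThree, bandRow, kernelThree]
  ring

theorem hankelD_neg_one (n : ℕ) :
    hankelD motzkinSeries 2 (-1) n = (-1) ^ n * kernelOne 1 n := by
  rw [show (-1 : ℤ) = -((0 + 1 : ℕ) : ℤ) by norm_num,
    hankelD_eq_det_symmEntry isCompatible_bandOne
      (fun l => by obtain _ | _ | _ | _ | l := l <;> simp [bandOne, bandRow]),
    det_banded_eq (w := 1) (symmEntry bandOne) (fun _ => kernelOne 1)]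
  · simp
  · exact fun k => symmEntry_of_eq_add _ rfl
  · exact fun k l h => symmEntry_eq_zero bandOne_eq_zero (Or.inl h)
  · intro s t
    fin_cases s; fin_cases t; simp [kernelOne]
  · exact fun _ k => sum_bandOne_mul_kernelOne 1 k

theorem hankelD_neg_two (n : ℕ) :
    hankelD motzkinSeries 2 (-2) n =
      kernelTwo 1 0 n * kernelTwo 0 1 (n + 1) - kernelTwo 1 0 (n + 1) * kernelTwo 0 1 n := by
  rw [show (-2 : ℤ) = -((1 + 1 : ℕ) : ℤ) by norm_num,
    hankelD_eq_det_symmEntry isCompatible_bandTwo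
      (fun l => by obtain _ | _ | _ | _ | l := l <;> simp [bandTwo, bandRow]),
    det_banded_eq (w := 2) (symmEntry bandTwo) ![kernelTwo 1 0, kernelTwo 0 1]]
  · simp [Matrix.det_fin_two, pow_mul]
  · intro k
    rw [symmEntry_of_eq_add _ rfl]
    obtain _ | _ | k := k <;> rfl
  · exact fun k l h => symmEntry_eq_zero bandTwo_eq_zero (Or.inl h)
  · intro s t
    fin_cases s <;> fin_cases t <;> simp [kernelTwo]
  · intro s k
    fin_cases s <;> exact sum_bandTwo_mul_kernelTwo _ _ k

theorem hankelD_neg_three (n : ℕ) :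
    hankelD motzkinSeries 2 (-3) n = (-1) ^ n *
      !![kernelThree 1 0 0 n, kernelThree 1 0 0 (n + 1), kernelThree 1 0 0 (n + 2);
        kernelThree 0 1 0 n, kernelThree 0 1 0 (n + 1), kernelThree 0 1 0 (n + 2);
        kernelThree 0 0 1 n, kernelThree 0 0 1 (n + 1), kernelThree 0 0 1 (n + 2)].det := by
  rw [show (-3 : ℤ) = -((2 + 1 : ℕ) : ℤ) by norm_num,
    hankelD_eq_det_symmEntry isCompatible_bandThree
      (fun l => by obtain _ | _ | _ | _ | l := l <;> simp [bandThree, bandRow]),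
    det_banded_eq (w := 3) (symmEntry bandThree)
      ![kernelThree 1 0 0, kernelThree 0 1 0, kernelThree 0 0 1]]
  · rw [pow_mul]
    congr 2
    · norm_num
    · ext s t
      fin_cases s <;> fin_cases t <;> rfl
  · intro k
    rw [symmEntry_of_eq_add _ rfl]
    obtain _ | _ | _ | k := k <;> rfl
  · exact fun k l h => symmEntry_eq_zero bandThree_eq_zero (Or.inl h)
  · intro s t
    fin_cases s <;> fin_cases t <;> simp [kernelThree]
  · intro s k
    fin_cases s <;> exact sum_bandThree_mul_kernelThree _ _ _ k

/-! ### Closed forms of the kernels and of the determinants -/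

lemma kernelOne_values (a : ℝ) (q : ℕ) :
    kernelOne a (4 * q) = a ∧ kernelOne a (4 * q + 1) = 0 := by
  induction q with
  | zero => simp [kernelOne]
  | succ q ih => simpa [mul_add, kernelOne] using ih

lemma kernelTwo_values (a b : ℝ) (q : ℕ) :
    kernelTwo a b (12 * q + 1) = b ∧ kernelTwo a b (12 * q + 2) = 0 ∧
    kernelTwo a b (12 * q + 3) = -b ∧ kernelTwo a b (12 * q + 4) = -a := by
  induction q with
  | zero => simp [kernelTwo]
  | succ q ih =>
    obtain ⟨h1, h2, h3, h4⟩ := ih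
    simp only [mul_add, mul_one, add_assoc, Nat.reduceAdd]
    simp only [kernelTwo, h1, h2, h3, h4]
    refine ⟨?_, ?_, ?_, ?_⟩ <;> ring

/-- The passage from the first to the second half of a period, for `x` periods elapsed. -/
lemma kernelThree_add_six {a b c x : ℝ} {m : ℕ}
    (h : kernelThree a b c (m + 1) = 4 * x * a + b ∧ kernelThree a b c (m + 2) = 4 * x * a + c ∧
      kernelThree a b c (m + 3) = -8 * x * a ∧ kernelThree a b c (m + 4) = 4 * x * a - c ∧
      kernelThree a b c (m + 5) = 4 * x * a - b ∧
      kernelThree a b c (m + 6) = -(8 * x + 1) * a + b + c) :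
    kernelThree a b c (m + 7) = (4 * x + 2) * a + b ∧
    kernelThree a b c (m + 8) = 4 * x * a - 2 * b - c ∧
    kernelThree a b c (m + 9) = -(8 * x + 4) * a ∧
    kernelThree a b c (m + 10) = (4 * x + 4) * a + 2 * b + c ∧
    kernelThree a b c (m + 11) = (4 * x + 2) * a - b ∧
    kernelThree a b c (m + 12) = -(8 * x + 7) * a - b - c := by
  obtain ⟨h1, h2, h3, h4, h5, h6⟩ := h
  simp only [kernelThree, h1, h2, h3, h4, h5, h6]
  refine ⟨?_, ?_, ?_, ?_, ?_, ?_⟩ <;> ring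

/-- The passage from the second half of a period to the first half of the next one. -/
lemma kernelThree_next_period {a b c x : ℝ} {m : ℕ}
    (h : kernelThree a b c (m + 1) = (4 * x + 2) * a + b ∧
      kernelThree a b c (m + 2) = 4 * x * a - 2 * b - c ∧
      kernelThree a b c (m + 3) = -(8 * x + 4) * a ∧
      kernelThree a b c (m + 4) = (4 * x + 4) * a + 2 * b + c ∧
      kernelThree a b c (m + 5) = (4 * x + 2) * a - b ∧
      kernelThree a b c (m + 6) = -(8 * x + 7) * a - b - c) :
    kernelThree a b c (m + 7) = 4 * (x + 1) * a + b ∧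
    kernelThree a b c (m + 8) = 4 * (x + 1) * a + c ∧
    kernelThree a b c (m + 9) = -8 * (x + 1) * a ∧
    kernelThree a b c (m + 10) = 4 * (x + 1) * a - c ∧
    kernelThree a b c (m + 11) = 4 * (x + 1) * a - b ∧
    kernelThree a b c (m + 12) = -(8 * (x + 1) + 1) * a + b + c := by
  obtain ⟨h1, h2, h3, h4, h5, h6⟩ := h
  simp only [kernelThree, h1, h2, h3, h4, h5, h6]
  refine ⟨?_, ?_, ?_, ?_, ?_, ?_⟩ <;> ring

lemma kernelThree_values (a b c : ℝ) (q : ℕ) :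
    kernelThree a b c (12 * q + 1) = 4 * q * a + b ∧
    kernelThree a b c (12 * q + 2) = 4 * q * a + c ∧
    kernelThree a b c (12 * q + 3) = -8 * q * a ∧
    kernelThree a b c (12 * q + 4) = 4 * q * a - c ∧
    kernelThree a b c (12 * q + 5) = 4 * q * a - b ∧
    kernelThree a b c (12 * q + 6) = -(8 * q + 1) * a + b + c := by
  induction q with
  | zero => simp [kernelThree]
  | succ q ih =>
    simpa only [mul_add, mul_one, add_assoc, Nat.reduceAdd, Nat.cast_add, Nat.cast_one] using
      kernelThree_next_period (m := 12 * q + 6) (kernelThree_add_six ih)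

theorem hankelD_neg_one_values (q : ℕ) :
    hankelD motzkinSeries 2 (-1) (4 * q) = 1 ∧
    hankelD motzkinSeries 2 (-1) (4 * q + 1) = 0 ∧
    hankelD motzkinSeries 2 (-1) (4 * q + 2) = -1 ∧
    hankelD motzkinSeries 2 (-1) (4 * q + 3) = 0 := by
  obtain ⟨h0, h1⟩ := kernelOne_values 1 q
  simp [hankelD_neg_one, kernelOne, h0, h1, pow_add, pow_mul, (by norm_num : (-1 : ℝ) ^ 4 = 1)]

theorem hankelD_neg_two_values (q : ℕ) :
    hankelD motzkinSeries 2 (-2) (12 * q + 1) = 0 ∧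
    hankelD motzkinSeries 2 (-2) (12 * q + 2) = 0 ∧
    hankelD motzkinSeries 2 (-2) (12 * q + 3) = -1 ∧
    hankelD motzkinSeries 2 (-2) (12 * q + 4) = -1 ∧
    hankelD motzkinSeries 2 (-2) (12 * q + 5) = -1 ∧
    hankelD motzkinSeries 2 (-2) (12 * q + 6) = -1 ∧
    hankelD motzkinSeries 2 (-2) (12 * q + 7) = 0 ∧
    hankelD motzkinSeries 2 (-2) (12 * q + 8) = 0 ∧
    hankelD motzkinSeries 2 (-2) (12 * q + 9) = 1 ∧
    hankelD motzkinSeries 2 (-2) (12 * q + 10) = 1 ∧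
    hankelD motzkinSeries 2 (-2) (12 * q + 11) = 1 ∧
    hankelD motzkinSeries 2 (-2) (12 * q + 12) = 1 := by
  obtain ⟨h1, h2, h3, h4⟩ := kernelTwo_values 1 0 q
  obtain ⟨k1, k2, k3, k4⟩ := kernelTwo_values 0 1 q
  simp only [hankelD_neg_two, add_assoc, Nat.reduceAdd, kernelTwo, h1, h2, h3, h4, k1, k2, k3, k4]
  norm_num

theorem hankelD_neg_three_values (q : ℕ) :
    hankelD motzkinSeries 2 (-3) (12 * q + 1) = 8 * q ∧
    hankelD motzkinSeries 2 (-3) (12 * q + 2) = 0 ∧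
    hankelD motzkinSeries 2 (-3) (12 * q + 3) = -8 * q ∧
    hankelD motzkinSeries 2 (-3) (12 * q + 4) = 1 ∧
    hankelD motzkinSeries 2 (-3) (12 * q + 5) = 8 * q + 2 ∧
    hankelD motzkinSeries 2 (-3) (12 * q + 6) = -1 ∧
    hankelD motzkinSeries 2 (-3) (12 * q + 7) = -8 * q - 4 ∧
    hankelD motzkinSeries 2 (-3) (12 * q + 8) = 0 ∧
    hankelD motzkinSeries 2 (-3) (12 * q + 9) = 8 * q + 4 ∧
    hankelD motzkinSeries 2 (-3) (12 * q + 10) = -1 ∧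
    hankelD motzkinSeries 2 (-3) (12 * q + 11) = -8 * q - 6 ∧
    hankelD motzkinSeries 2 (-3) (12 * q + 12) = 1 := by
  have h := kernelThree_values 1 0 0 q
  obtain ⟨h7, h8, h9, h10, h11, h12⟩ := kernelThree_add_six h
  obtain ⟨h1, h2, h3, h4, h5, h6⟩ := h
  obtain ⟨h13, h14, -⟩ := kernelThree_values 1 0 0 (q + 1)
  have k := kernelThree_values 0 1 0 q
  obtain ⟨k7, k8, k9, k10, k11, k12⟩ := kernelThree_add_six k
  obtain ⟨k1, k2, k3, k4, k5, k6⟩ := k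
  obtain ⟨k13, k14, -⟩ := kernelThree_values 0 1 0 (q + 1)
  have l := kernelThree_values 0 0 1 q
  obtain ⟨l7, l8, l9, l10, l11, l12⟩ := kernelThree_add_six l
  obtain ⟨l1, l2, l3, l4, l5, l6⟩ := l
  obtain ⟨l13, l14, -⟩ := kernelThree_values 0 0 1 (q + 1)
  simp only [mul_add, mul_one, add_assoc, Nat.reduceAdd, Nat.cast_add, Nat.cast_one]
    at h13 h14 k13 k14 l13 l14
  have hpow : (-1 : ℝ) ^ (12 * q) = 1 := by rw [pow_mul]; norm_num
  refine ⟨?_, ?_, ?_, ?_, ?_, ?_, ?_, ?_, ?_, ?_, ?_, ?_⟩ <;>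
    rw [hankelD_neg_three, Matrix.det_fin_three, pow_add, hpow] <;>
    simp only [Matrix.of_apply, Matrix.cons_val, add_assoc, Nat.reduceAdd,
      h1, h2, h3, h4, h5, h6, h7, h8, h9, h10, h11, h12, h13, h14, k1, k2, k3, k4, k5, k6, k7,
      k8, k9, k10, k11, k12, k13, k14, l1, l2, l3, l4, l5, l6, l7, l8, l9, l10, l11, l12, l13,
      l14] <;>
    ring

end MotzkinHankel

theorem proposition4p3 :
    (∀ n : ℕ,
      (n ≡ 0 [MOD 4] → MotzkinHankel.hankelD MotzkinHankel.motzkinSeries 2 (-1) n = 1) ∧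
      (n ≡ 1 [MOD 4] ∨ n ≡ 3 [MOD 4] →
        MotzkinHankel.hankelD MotzkinHankel.motzkinSeries 2 (-1) n = 0) ∧
      (n ≡ 2 [MOD 4] → MotzkinHankel.hankelD MotzkinHankel.motzkinSeries 2 (-1) n = -1)) ∧
    (∀ n : ℕ,
      (n ≡ 0 [MOD 12] ∨ n ≡ 9 [MOD 12] ∨ n ≡ 10 [MOD 12] ∨ n ≡ 11 [MOD 12] →
        MotzkinHankel.hankelD MotzkinHankel.motzkinSeries 2 (-2) n = 1) ∧
      (n ≡ 1 [MOD 12] ∨ n ≡ 2 [MOD 12] ∨ n ≡ 7 [MOD 12] ∨ n ≡ 8 [MOD 12] →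
        MotzkinHankel.hankelD MotzkinHankel.motzkinSeries 2 (-2) n = 0) ∧
      (n ≡ 3 [MOD 12] ∨ n ≡ 4 [MOD 12] ∨ n ≡ 5 [MOD 12] ∨ n ≡ 6 [MOD 12] →
        MotzkinHankel.hankelD MotzkinHankel.motzkinSeries 2 (-2) n = -1)) ∧
    (∀ n : ℕ, 4 ≤ n →
      (n ≡ 0 [MOD 12] ∨ n ≡ 4 [MOD 12] →
        MotzkinHankel.hankelD MotzkinHankel.motzkinSeries 2 (-3) n = 1) ∧
      (n ≡ 2 [MOD 12] ∨ n ≡ 8 [MOD 12] →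
        MotzkinHankel.hankelD MotzkinHankel.motzkinSeries 2 (-3) n = 0) ∧
      (n ≡ 6 [MOD 12] ∨ n ≡ 10 [MOD 12] →
        MotzkinHankel.hankelD MotzkinHankel.motzkinSeries 2 (-3) n = -1) ∧
      (∀ k : ℕ, n = 12 * k + 1 →
        MotzkinHankel.hankelD MotzkinHankel.motzkinSeries 2 (-3) n = 8 * (k : ℝ)) ∧
      (∀ k : ℕ, n = 12 * k + 3 →
        MotzkinHankel.hankelD MotzkinHankel.motzkinSeries 2 (-3) n = -8 * (k : ℝ)) ∧
      (∀ k : ℕ, n = 12 * k + 5 →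
        MotzkinHankel.hankelD MotzkinHankel.motzkinSeries 2 (-3) n = 8 * (k : ℝ) + 2) ∧
      (∀ k : ℕ, n = 12 * k + 7 →
        MotzkinHankel.hankelD MotzkinHankel.motzkinSeries 2 (-3) n = -8 * (k : ℝ) - 4) ∧
      (∀ k : ℕ, n = 12 * k + 9 →
        MotzkinHankel.hankelD MotzkinHankel.motzkinSeries 2 (-3) n = 8 * (k : ℝ) + 4) ∧
      (∀ k : ℕ, n = 12 * k + 11 →
        MotzkinHankel.hankelD MotzkinHankel.motzkinSeries 2 (-3) n = -8 * (k : ℝ) - 6)) := by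
  -- Residues are taken in `1, …, 12`, since the closed forms of the kernels start at index `1`.
  have hmod (n : ℕ) : n = 0 ∨ ∃ q r, r < 12 ∧ n = 12 * q + (r + 1) := by
    obtain _ | n := n
    · exact Or.inl rfl
    · exact Or.inr ⟨n / 12, n % 12, by omega, by omega⟩
  refine ⟨fun n => ?_, fun n => ?_, fun n _ => ?_⟩
  · obtain ⟨q, r, hr, rfl⟩ : ∃ q r, r < 4 ∧ n = 4 * q + r :=
      ⟨n / 4, n % 4, Nat.mod_lt _ (by norm_num), (Nat.div_add_mod n 4).symm⟩
    obtain ⟨h0, h1, h2, h3⟩ := MotzkinHankel.hankelD_neg_one_values q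
    interval_cases r <;> simp [Nat.ModEq, *]
  · obtain rfl | ⟨q, r, hr, rfl⟩ := hmod n
    · simp [Nat.ModEq, MotzkinHankel.hankelD]
    · obtain ⟨h1, h2, h3, h4, h5, h6, h7, h8, h9, h10, h11, h12⟩ :=
        MotzkinHankel.hankelD_neg_two_values q
      interval_cases r <;> simp [Nat.ModEq, *]
  · obtain rfl | ⟨q, r, hr, rfl⟩ := hmod n
    · omega
    · obtain ⟨h1, h2, h3, h4, h5, h6, h7, h8, h9, h10, h11, h12⟩ :=
        MotzkinHankel.hankelD_neg_three_values q
      refine ⟨?_, ?_, ?_, fun k hk => ?_, fun k hk => ?_, fun k hk => ?_, fun k hk => ?_,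
        fun k hk => ?_, fun k hk => ?_⟩
      iterate 3 interval_cases r <;> simp [Nat.ModEq, *]
      all_goals
        interval_cases r <;>
          first
          | (exfalso; omega)
          | (obtain rfl : q = k := by omega); simp [*]
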